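/- Consider the linear bandit in $\mathbb R^d$ with action set the closed Euclidean unit ball $\mathcal A=\{x\in\mathbb R^d:\|x\|\le 1\}$. In each round $t=1,\dots,N$ the agent picks $x_t\in\mathcal A$ and observes $y_t=x_t^\top\theta+\eta_t$, where the noise $\eta_1,\eta_2,\dots$ is i.i.d. with a law $\nu$ from a class $\mathcal N$ of $1$-sub-Gaussian laws (i.e. $\int e^{s\eta}\,d\nu(\eta)\le e^{s^2/2}$ for all $s\in\mathbb R$) that contains the standard Gaussian law (for instance, $\mathcal N$ consists of the standard Gaussian law alone, or of all $1$-sub-Gaussian laws). A policy chooses $x_t$, possibly at random, on the basis of the past actions and rewards; let $\mathcal P$ be the set of all policies. The regret is $R_N=\sum_{t=1}^N(x^*-x_t)^\top\theta$, where $x^*$ maximizes $x^\top\theta$ over $\mathcal A$. For every $\phi_{\max}>0$ there is a constant $c>0$, depending only on $\phi_{\max}$, such that the following holds. Let $r<d$ and $N>d^2$ be natural numbers, let $B\in\mathbb R^{d\times r}$ have rank $r$ (for instance, have orthonormal columns), let $\phi_{\min}\in[0,\phi_{\max}]$, with $\phi_{\min}=0$ if $r=1$, and let $\mathcal I=\{B\alpha:\alpha\in\mathbb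 R^r,\ \phi_{\min}\le\|B\alpha\|\le\phi_{\max}\}$ be the set of possible tasks. The policies may depend on $B$, $N$, $\phi_{\min}$, $\phi_{\max}$ and $\mathcal N$. Then $$\inf_{\mathcal P}\ \sup_{\theta\in\mathcal I,\ \nu\in\mathcal N}\ \mathbb E R_N\ \ge\ c\,r\sqrt N .$$ -/

import Mathlib

open MeasureTheory ProbabilityTheory
open scoped ENNReal

namespace LinearBandit

/-- The action set: the closed Euclidean unit ball of `ℝ^d`. -/
abbrev Action (d : ℕ) : Type :=
  Metric.closedBall (0 : EuclideanSpace ℝ (Fin d)) 1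

/-- The observations of the first `t` rounds: the pairs (action, reward). -/
abbrev History (d t : ℕ) : Type := Fin t → Action d × ℝ

/-- A (possibly randomized) policy: in each round it draws an action from a distribution that
depends measurably on all past actions and rewards. -/
structure Policy (d : ℕ) where
  act : ∀ t : ℕ, Kernel (History d t) (Action d)
  markov : ∀ t : ℕ, IsMarkovKernel (act t)

instance markov_act (d : ℕ) (π : Policy d) (t : ℕ) : IsMarkovKernel (π.act t) := π.markov t

/-- There is a policy, for instance the one that always plays the centre of the ball. -/
instance nonempty_policy (d : ℕ) : Nonempty (Policy d) :=
  ⟨⟨fun _ => Kernel.const _ (Measure.dirac ⟨0, by simp⟩), fun _ => inferInstance⟩⟩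

/-- One more round: action `x` is played, noise `η` occurs, and the pair `(x, xᵀθ + η)` is
appended to the history. -/
noncomputable def extend {d : ℕ} (θ : EuclideanSpace ℝ (Fin d)) (t : ℕ)
    (p : (History d t × Action d) × ℝ) : History d (t + 1) :=
  Fin.snoc (α := fun _ => Action d × ℝ) p.1.1
    (p.1.2, inner ℝ (p.1.2 : EuclideanSpace ℝ (Fin d)) θ + p.2)

/-- The law of the history of the first `t` rounds when policy `π` plays the task `θ`, the noise
being i.i.d. with law `ν`: in each round the action is drawn by the policy given the past, and the
noise is independent of the past and of the action. -/
noncomputable def historyLaw {d : ℕ} (π : Policy d) (θ : EuclideanSpace ℝ (Fin d))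
    (ν : ProbabilityMeasure ℝ) : (t : ℕ) → Measure (History d t)
  | 0 => Measure.dirac Fin.elim0
  | t + 1 => (((historyLaw π θ ν t) ⊗ₘ (π.act t)).prod (ν : Measure ℝ)).map (extend θ t)

/-- The regret `∑ t, (x* - x_t)ᵀ θ`, where `x*` maximizes `xᵀθ` over the action set. -/
noncomputable def regret {d N : ℕ} (θ : EuclideanSpace ℝ (Fin d)) (h : History d N) : ℝ :=
  ∑ t : Fin N, ((⨆ x : Action d, inner ℝ (x : EuclideanSpace ℝ (Fin d)) θ)
    - inner ℝ ((h t).1 : EuclideanSpace ℝ (Fin d)) θ)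

/-- The expected regret over `N` rounds (the regret is nonnegative, see `regret_nonneg`). -/
noncomputable def expectedRegret {d : ℕ} (π : Policy d) (θ : EuclideanSpace ℝ (Fin d))
    (ν : ProbabilityMeasure ℝ) (N : ℕ) : ℝ≥0∞ :=
  ∫⁻ h, ENNReal.ofReal (regret θ h) ∂(historyLaw π θ ν N)

/-- The minimax expected regret over `N` rounds, for the class `I` of tasks and the class `𝒩` of
noise laws. -/
noncomputable def minimaxRegret {d : ℕ} (I : Set (EuclideanSpace ℝ (Fin d)))
    (𝒩 : Set (ProbabilityMeasure ℝ)) (N : ℕ) : ℝ≥0∞ :=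
  ⨅ π : Policy d, ⨆ θ ∈ I, ⨆ ν ∈ 𝒩, expectedRegret π θ ν N

/-- The possible tasks given the representation `B`: the `θ = B α` with
`φmin ≤ ‖θ‖ ≤ φmax`. -/
def tasks {d r : ℕ} (B : Matrix (Fin d) (Fin r) ℝ) (φmin φmax : ℝ) :
    Set (EuclideanSpace ℝ (Fin d)) :=
  {θ | (∃ α : Fin r → ℝ, θ = WithLp.toLp 2 (B.mulVec α)) ∧ φmin ≤ ‖θ‖ ∧ ‖θ‖ ≤ φmax}

/-- The 1-sub-Gaussian noise laws: `E exp(s η) ≤ exp(s² / 2)` for all real `s`. -/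
def subGaussianNoise : Set (ProbabilityMeasure ℝ) :=
  {ν | HasSubgaussianMGF id 1 (ν : Measure ℝ)}

/-- The standard Gaussian noise law. -/
noncomputable def gaussianNoise : ProbabilityMeasure ℝ := ⟨gaussianReal 0 1, inferInstance⟩

theorem gaussianNoise_mem : gaussianNoise ∈ subGaussianNoise := by
  refine ⟨fun t => ?_, fun t => ?_⟩
  · exact integrable_exp_mul_gaussianReal t
  · have h := congrFun (mgf_id_gaussianReal (μ := 0) (v := 1)) t
    change mgf id (gaussianReal 0 1) t ≤ _
    rw [h]; simp

theorem measurable_extend {d : ℕ} (θ : EuclideanSpace ℝ (Fin d)) (t : ℕ) :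
    Measurable (extend θ t) := by
  refine measurable_pi_iff.2 fun i => ?_
  refine Fin.lastCases ?_ (fun j => ?_) i
  · simp only [extend, Fin.snoc_last]
    fun_prop
  · simp only [extend, Fin.snoc_castSucc]
    fun_prop

instance isProbabilityMeasure_historyLaw {d : ℕ} (π : Policy d) (θ : EuclideanSpace ℝ (Fin d)) (ν : ProbabilityMeasure ℝ)
    (t : ℕ) : IsProbabilityMeasure (historyLaw π θ ν t) := by
  induction t with
  | zero => rw [historyLaw]; infer_instance
  | succ t ih =>
    rw [historyLaw]
    exact Measure.isProbabilityMeasure_map (measurable_extend θ t).aemeasurable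

theorem regret_nonneg {d N : ℕ} (θ : EuclideanSpace ℝ (Fin d)) (h : History d N) :
    0 ≤ regret θ h := by
  refine Finset.sum_nonneg fun t _ => sub_nonneg.2 ?_
  refine le_ciSup (f := fun x : Action d => inner ℝ (x : EuclideanSpace ℝ (Fin d)) θ)
    ⟨‖θ‖, ?_⟩ (h t).1
  rintro _ ⟨x, rfl⟩
  have hx : ‖(x : EuclideanSpace ℝ (Fin d))‖ ≤ 1 := mem_closedBall_zero_iff.1 x.2
  calc inner ℝ (x : EuclideanSpace ℝ (Fin d)) θ
      ≤ ‖(x : EuclideanSpace ℝ (Fin d))‖ * ‖θ‖ := real_inner_le_norm _ _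
    _ ≤ 1 * ‖θ‖ := by gcongr
    _ = ‖θ‖ := one_mul _

end LinearBandit

/-! Gaussian noise alone forces the bound. Let r ≥ 2, m = r - 1, and let u₀, …, uₘ be an orthonormal
basis of the column space. The tasks are φmax·W_σ with W_σ = √(1 - mδ²) u₀ + δ ∑ σᵢ uᵢ, σ a sign
vector; they have norm φmax, so any φmin is allowed. Since the ball is curved, a round costs at
least (φmax/2) ∑ (xᵢ - δσᵢ)², where xᵢ = ⟨x, uᵢ⟩. Flipping σᵢ moves the task by 2φmax·δ along uᵢ,
and a round gives information of order φmax²δ²xᵢ² about this flip. Low regret keeps xᵢ near ±δ,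
hence total information of order Nφmax²δ⁴. With δ² of order 1/√N the sign stays undecided and costs
of order Nδ² ~ √N (`le_deviation_add_deviation`, from `two_point_bound`). Averaging over the
hypercube (`exists_vertex_le_sum`) adds up the m coordinates. The condition N > d² ensures mδ² ≤ 1.
For r = 1 there is no direction orthogonal to the pole, so the tasks are ±Δu with Δ ~ 1/√N; these
short tasks are admissible because φmin = 0. -/

namespace LinearBandit

variable {d : ℕ}

/-! ### Likelihood ratios and change of measure -/

/-- The logarithm of the likelihood ratio between the tasks `θ + v` and `θ` for standard Gaussian
noise. -/
noncomputable def logLikelihoodRatio (θ v : EuclideanSpace ℝ (Fin d)) {t : ℕ}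
    (h : History d t) : ℝ :=
  ∑ s, (((h s).2 - inner ℝ ((h s).1 : EuclideanSpace ℝ (Fin d)) θ) *
    inner ℝ ((h s).1 : EuclideanSpace ℝ (Fin d)) v -
    inner ℝ ((h s).1 : EuclideanSpace ℝ (Fin d)) v ^ 2 / 2)

theorem measurable_logLikelihoodRatio (θ v : EuclideanSpace ℝ (Fin d)) (t : ℕ) :
    Measurable (logLikelihoodRatio θ v : History d t → ℝ) := by
  unfold logLikelihoodRatio
  fun_prop

/-- The linear terms for `v` and `-v` cancel. An upper bound for `-v`, available from Markov's
inequality, thus becomes a lower bound for `v`. -/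
theorem logLikelihoodRatio_neg (θ v : EuclideanSpace ℝ (Fin d)) {t : ℕ} (h : History d t) :
    logLikelihoodRatio θ v h = -logLikelihoodRatio θ (-v) h -
      ∑ s, inner ℝ ((h s).1 : EuclideanSpace ℝ (Fin d)) v ^ 2 := by
  simp only [logLikelihoodRatio, inner_neg_right, ← Finset.sum_neg_distrib,
    ← Finset.sum_sub_distrib]
  refine Finset.sum_congr rfl fun s _ => ?_
  ring

theorem logLikelihoodRatio_extend (θ v : EuclideanSpace ℝ (Fin d)) (t : ℕ)
    (h : History d t) (x : Action d) (η : ℝ) :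
    logLikelihoodRatio θ v (extend θ t ((h, x), η)) = logLikelihoodRatio θ v h +
      (η * inner ℝ (x : EuclideanSpace ℝ (Fin d)) v -
        inner ℝ (x : EuclideanSpace ℝ (Fin d)) v ^ 2 / 2) := by
  simp only [logLikelihoodRatio, Fin.sum_univ_castSucc, extend, Fin.snoc_castSucc, Fin.snoc_last,
    add_sub_cancel_left]

theorem lintegral_gaussianReal_add (b : ℝ) {F : ℝ → ℝ≥0∞} (hF : Measurable F) :
    ∫⁻ η, F (b + η) ∂(gaussianReal 0 1) =
      ∫⁻ η, F η * ENNReal.ofReal (Real.exp (η * b - b ^ 2 / 2)) ∂(gaussianReal 0 1) := by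
  have h1 : (gaussianReal 0 1).map (b + ·) = gaussianReal b 1 := by
    simpa using gaussianReal_map_const_add (μ := 0) (v := 1) b
  rw [← lintegral_map (f := F) (g := fun η => b + η) hF (by fun_prop), h1,
    gaussianReal_of_var_ne_zero _ one_ne_zero, gaussianReal_of_var_ne_zero _ one_ne_zero,
    lintegral_withDensity_eq_lintegral_mul _ (by fun_prop) hF,
    lintegral_withDensity_eq_lintegral_mul _ (by fun_prop) (by fun_prop)]
  refine lintegral_congr fun η => ?_
  simp only [Pi.mul_apply, gaussianPDF]
  rw [mul_comm (F η), ← mul_assoc, ← ENNReal.ofReal_mul (gaussianPDFReal_nonneg _ _ _)]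
  congr 2
  simp only [gaussianPDFReal, mul_assoc, ← Real.exp_add]
  congr 3
  push_cast
  ring

theorem lintegral_historyLaw_succ (π : Policy d) (θ : EuclideanSpace ℝ (Fin d))
    (ν : ProbabilityMeasure ℝ) (t : ℕ) {F : History d (t + 1) → ℝ≥0∞} (hF : Measurable F) :
    ∫⁻ h, F h ∂(historyLaw π θ ν (t + 1)) =
      ∫⁻ h, ∫⁻ x, ∫⁻ η, F (extend θ t ((h, x), η)) ∂(ν : Measure ℝ) ∂(π.act t h)
        ∂(historyLaw π θ ν t) := by
  have hG : Measurable fun p => F (extend θ t p) := hF.comp (measurable_extend θ t)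
  rw [historyLaw, lintegral_map hF (measurable_extend θ t), lintegral_prod _ hG.aemeasurable,
    Measure.lintegral_compProd hG.lintegral_prod_right']

/-- Change of measure between two tasks with standard Gaussian noise. -/
theorem lintegral_historyLaw_add (π : Policy d) (θ v : EuclideanSpace ℝ (Fin d)) (t : ℕ)
    {F : History d t → ℝ≥0∞} (hF : Measurable F) :
    ∫⁻ h, F h ∂(historyLaw π (θ + v) gaussianNoise t) =
      ∫⁻ h, F h * ENNReal.ofReal (Real.exp (logLikelihoodRatio θ v h))
        ∂(historyLaw π θ gaussianNoise t) := by
  induction t with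
  | zero =>
    simp only [historyLaw]
    refine lintegral_congr fun h => ?_
    simp [logLikelihoodRatio]
  | succ t ih =>
    have hL := measurable_logLikelihoodRatio θ v (t + 1)
    have hG : Measurable fun p : (History d t × Action d) × ℝ => F (extend (θ + v) t p) :=
      hF.comp (measurable_extend _ t)
    have hF' := fun (h : History d t) (x : Action d) =>
      (hF.comp (measurable_extend θ t)).comp (measurable_prodMk_left (x := (h, x)))
    rw [lintegral_historyLaw_succ _ _ _ _ hF, lintegral_historyLaw_succ _ _ _ _ (by fun_prop),
      ih hG.lintegral_prod_right'.lintegral_kernel_prod_right']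
    refine lintegral_congr fun h => ?_
    rw [← lintegral_mul_const' _ _ ENNReal.ofReal_ne_top]
    refine lintegral_congr fun x => ?_
    have key := lintegral_gaussianReal_add (inner ℝ (x : EuclideanSpace ℝ (Fin d)) v) (hF' h x)
    -- Changing the task has the same effect on the reward as shifting the noise by ⟨x, v⟩.
    have hext : ∀ η, extend (θ + v) t ((h, x), η) =
        extend θ t ((h, x), inner ℝ (x : EuclideanSpace ℝ (Fin d)) v + η) := fun η => by
      simp only [extend, inner_add_right, add_assoc]
    simp only [hext, logLikelihoodRatio_extend, Real.exp_add,
      ENNReal.ofReal_mul (Real.exp_nonneg _)]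
    change (∫⁻ η, _ ∂(gaussianReal 0 1)) * _ = ∫⁻ η, _ ∂(gaussianReal 0 1)
    refine (congrArg (· * _) key).trans ?_
    rw [← lintegral_mul_const' _ _ ENNReal.ofReal_ne_top]
    refine lintegral_congr fun η => ?_
    simp only [Function.comp]
    ring

/-! ### Testing between two tasks -/

/-- If two tasks are hard to distinguish under the policy, then two losses that cannot be small
simultaneously cannot both have small expectation under the respective tasks. -/
theorem two_point_bound (π : Policy d) (θ v : EuclideanSpace ℝ (Fin d)) (N : ℕ)
    (hV : ∫⁻ h, ENNReal.ofReal (∑ s, inner ℝ ((h s).1 : EuclideanSpace ℝ (Fin d)) v ^ 2)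
      ∂(historyLaw π θ gaussianNoise N) ≤ ENNReal.ofReal (1 / 2))
    {f g : History d N → ℝ} (hf : Measurable f) (hg : Measurable g) {c : ℝ} (hc : 0 ≤ c)
    (hfg : ∀ h, c ≤ f h ∨ c ≤ g h) :
    ENNReal.ofReal (Real.exp (-4) / 10 * c) ≤
      ∫⁻ h, ENNReal.ofReal (f h) ∂(historyLaw π θ gaussianNoise N) +
      ∫⁻ h, ENNReal.ofReal (g h) ∂(historyLaw π (θ + v) gaussianNoise N) := by
  set P := historyLaw π θ gaussianNoise N with hP
  set V : History d N → ℝ :=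
    fun h => ∑ s, inner ℝ ((h s).1 : EuclideanSpace ℝ (Fin d)) v ^ 2 with hVdef
  have hVm : Measurable V := by fun_prop
  have hLm := measurable_logLikelihoodRatio θ (-v) N
  have hLm' := measurable_logLikelihoodRatio θ v N
  set A := {h | c ≤ f h}
  set B := {h | c ≤ g h}
  -- Off `S ∪ T` the likelihood ratio for `v` is at least exp(-4); Markov's inequality bounds both
  -- exceptional sets.
  set S := {h : History d N | 2 ≤ logLikelihoodRatio θ (-v) h}
  set T := {h : History d N | 2 ≤ V h}
  have hS : P.real S ≤ 1 / 5 := by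
    have h1 : ∫⁻ h, ENNReal.ofReal (Real.exp (logLikelihoodRatio θ (-v) h)) ∂P = 1 := by
      have := lintegral_historyLaw_add π θ (-v) N (F := fun _ => 1) measurable_const
      simpa using this.symm
    have h2 := mul_meas_ge_le_lintegral (μ := P)
      (f := fun h => ENNReal.ofReal (Real.exp (logLikelihoodRatio θ (-v) h))) (by fun_prop)
      (ENNReal.ofReal (Real.exp 2))
    rw [h1] at h2
    have h3 : S ⊆ {h | ENNReal.ofReal (Real.exp 2) ≤
        ENNReal.ofReal (Real.exp (logLikelihoodRatio θ (-v) h))} := fun h hh =>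
      ENNReal.ofReal_le_ofReal (Real.exp_le_exp.2 hh)
    have h4 : ENNReal.ofReal (Real.exp 2) * P S ≤ 1 :=
      (mul_le_mul_right (measure_mono h3) _).trans h2
    have h5 := ENNReal.toReal_mono ENNReal.one_ne_top h4
    rw [ENNReal.toReal_mul, ENNReal.toReal_ofReal (Real.exp_nonneg _), ENNReal.toReal_one] at h5
    change Real.exp 2 * P.real S ≤ 1 at h5
    have h6 : (5 : ℝ) ≤ Real.exp 2 := by
      have := Real.quadratic_le_exp_of_nonneg (x := 2) (by norm_num)
      linarith
    nlinarith [measureReal_nonneg (μ := P) (s := S)]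
  have hT : P.real T ≤ 1 / 4 := by
    have h2 := mul_meas_ge_le_lintegral (μ := P) (f := fun h => ENNReal.ofReal (V h))
      (by fun_prop) (ENNReal.ofReal 2)
    have h3 : T ⊆ {h | ENNReal.ofReal 2 ≤ ENNReal.ofReal (V h)} := fun h hh =>
      ENNReal.ofReal_le_ofReal hh
    have h4 := (mul_le_mul_right (measure_mono h3) _).trans (h2.trans hV)
    have h5 := ENNReal.toReal_mono ENNReal.ofReal_ne_top h4
    rw [ENNReal.toReal_mul, ENNReal.toReal_ofReal (by norm_num),
      ENNReal.toReal_ofReal (by norm_num)] at h5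
    change 2 * P.real T ≤ 1 / 2 at h5
    linarith
  have hAint : ENNReal.ofReal (c * P.real A) ≤ ∫⁻ h, ENNReal.ofReal (f h) ∂P := by
    rw [ENNReal.ofReal_mul hc, ofReal_measureReal]
    refine le_trans ?_ (mul_meas_ge_le_lintegral (f := fun h => ENNReal.ofReal (f h))
      (by fun_prop) (ENNReal.ofReal c))
    gcongr
    exact fun h hh => ENNReal.ofReal_le_ofReal hh
  have hBint : ENNReal.ofReal (c * Real.exp (-4) * P.real (B \ (S ∪ T))) ≤
      ∫⁻ h, ENNReal.ofReal (g h) ∂(historyLaw π (θ + v) gaussianNoise N) := by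
    rw [lintegral_historyLaw_add π θ v N (by fun_prop), ENNReal.ofReal_mul (by positivity),
      ofReal_measureReal]
    refine le_trans ?_ (mul_meas_ge_le_lintegral
      (f := fun h => ENNReal.ofReal (g h) *
        ENNReal.ofReal (Real.exp (logLikelihoodRatio θ v h)))
      (by fun_prop) (ENNReal.ofReal (c * Real.exp (-4))))
    gcongr
    rintro h ⟨hhB, hh⟩
    simp only [S, T, Set.mem_union, Set.mem_ofPred_eq, not_or, not_le] at hh
    have hhB : c ≤ g h := hhB
    have h1 := logLikelihoodRatio_neg θ v h
    change ENNReal.ofReal _ ≤ ENNReal.ofReal _ * ENNReal.ofReal _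
    rw [← ENNReal.ofReal_mul (hc.trans hhB)]
    have h2 : -4 ≤ logLikelihoodRatio θ v h := by
      have : V h < 2 := hh.2
      simp only [hVdef] at this
      linarith [hh.1]
    exact ENNReal.ofReal_le_ofReal
      (mul_le_mul hhB (Real.exp_le_exp.2 h2) (Real.exp_nonneg _) (hc.trans hhB))
  refine le_trans ?_ (add_le_add hAint hBint)
  rw [← ENNReal.ofReal_add (by positivity) (by positivity)]
  refine ENNReal.ofReal_le_ofReal ?_
  have hcover : 1 ≤ P.real A + P.real (B \ (S ∪ T)) + (P.real S + P.real T) := by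
    have hu : (Set.univ : Set (History d N)) ⊆ (A ∪ B \ (S ∪ T)) ∪ (S ∪ T) := by
      intro h _
      by_cases hh : h ∈ S ∪ T
      · exact Or.inr hh
      · exact Or.inl ((hfg h).imp id fun hb => ⟨hb, hh⟩)
    calc (1 : ℝ) = P.real Set.univ := by simp
      _ ≤ P.real ((A ∪ B \ (S ∪ T)) ∪ (S ∪ T)) := measureReal_mono hu
      _ ≤ P.real (A ∪ B \ (S ∪ T)) + P.real (S ∪ T) := measureReal_union_le _ _
      _ ≤ _ := add_le_add (measureReal_union_le _ _) (measureReal_union_le _ _)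
  have he : Real.exp (-4) ≤ 1 := Real.exp_le_one_iff.2 (by norm_num)
  have hA0 : 0 ≤ P.real A := measureReal_nonneg
  -- In fact 1 - 1/5 - 1/4 = 11/20 is available.
  have hsum : 1 / 10 ≤ P.real A + P.real (B \ (S ∪ T)) := by linarith
  have h7 : Real.exp (-4) * (1 / 10) ≤ P.real A + Real.exp (-4) * P.real (B \ (S ∪ T)) := by
    nlinarith [Real.exp_pos (-4)]
  nlinarith

/-! ### Geometry of the ball and averaging over the hypercube -/

/-- A matrix of full column rank has an orthonormal basis of its column space. -/
theorem exists_orthonormal_of_rank_eq {r : ℕ} {B : Matrix (Fin d) (Fin r) ℝ} (hB : B.rank = r) :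
    ∃ u : Fin r → EuclideanSpace ℝ (Fin d), Orthonormal ℝ u ∧
      ∀ a : Fin r → ℝ, ∃ α : Fin r → ℝ, ∑ i, a i • u i = WithLp.toLp 2 (B.mulVec α) := by
  set S : Submodule ℝ (EuclideanSpace ℝ (Fin d)) :=
    LinearMap.range ((WithLp.linearEquiv 2 ℝ (Fin d → ℝ)).symm.toLinearMap ∘ₗ B.mulVecLin)
  have hS : Module.finrank ℝ S = r := by
    have hmap : S = B.mulVecLin.range.map (WithLp.linearEquiv 2 ℝ (Fin d → ℝ)).symm.toLinearMap :=
      LinearMap.range_comp _ _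
    rw [hmap, LinearEquiv.finrank_map_eq]
    exact hB
  let b := (stdOrthonormalBasis ℝ S).reindex (finCongr hS)
  refine ⟨fun i => b i, b.orthonormal.comp_linearIsometry S.subtypeₗᵢ, fun a => ?_⟩
  have hmem : ∑ i, a i • (b i : EuclideanSpace ℝ (Fin d)) ∈ S :=
    S.sum_mem fun i _ => S.smul_mem _ (b i).2
  obtain ⟨α, hα⟩ := hmem
  exact ⟨α, hα.symm⟩

theorem norm_le_iSup_inner (θ : EuclideanSpace ℝ (Fin d)) :
    ‖θ‖ ≤ ⨆ x : Action d, inner ℝ (x : EuclideanSpace ℝ (Fin d)) θ := by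
  have hbdd : BddAbove
      (Set.range fun x : Action d => inner ℝ (x : EuclideanSpace ℝ (Fin d)) θ) := by
    refine ⟨‖θ‖, ?_⟩
    rintro _ ⟨x, rfl⟩
    have hx : ‖(x : EuclideanSpace ℝ (Fin d))‖ ≤ 1 := mem_closedBall_zero_iff.1 x.2
    exact (real_inner_le_norm _ _).trans (mul_le_of_le_one_left (norm_nonneg _) hx)
  -- For θ = 0 this maximizer is 0, since `0⁻¹ = 0`.
  have hmem : ‖θ‖⁻¹ • θ ∈ Metric.closedBall (0 : EuclideanSpace ℝ (Fin d)) 1 := by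
    rw [mem_closedBall_zero_iff, norm_smul, norm_inv, norm_norm]
    exact inv_mul_le_one
  refine le_trans (le_of_eq ?_) (le_ciSup hbdd ⟨_, hmem⟩)
  rw [real_inner_smul_left, real_inner_self_eq_norm_sq]
  rcases eq_or_ne ‖θ‖ 0 with h | h
  · simp [h]
  · field_simp

theorem sum_norm_sub_inner_le_regret {N : ℕ} (θ : EuclideanSpace ℝ (Fin d)) (h : History d N) :
    ∑ t, (‖θ‖ - inner ℝ ((h t).1 : EuclideanSpace ℝ (Fin d)) θ) ≤ regret θ h :=
  Finset.sum_le_sum fun _ _ => sub_le_sub_right (norm_le_iSup_inner θ) _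

/-- In the unit ball, the regret of a direction controls the squared distance to it. -/
theorem half_norm_sub_sq_le {x w : EuclideanSpace ℝ (Fin d)} (hx : ‖x‖ ≤ 1) (hw : ‖w‖ = 1) :
    ‖x - w‖ ^ 2 / 2 ≤ 1 - inner ℝ x w := by
  rw [norm_sub_sq_real, hw]
  nlinarith [norm_nonneg x]

/-- A finite family of losses indexed by sign vectors, with total loss at least `C` along each edge
of the hypercube, is large on average at some vertex. -/
theorem exists_vertex_le_sum {m : ℕ} (ρ : (Fin m → Bool) → Fin m → ℝ≥0∞) (C : ℝ≥0∞)
    (hρ : ∀ σ i, C ≤ ρ σ i + ρ (Function.update σ i (!σ i)) i) :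
    ∃ σ, (m : ℝ≥0∞) * C ≤ 2 * ∑ i, ρ σ i := by
  have hflip : ∀ i, ∑ σ : Fin m → Bool, ρ (Function.update σ i (!σ i)) i = ∑ σ, ρ σ i := by
    intro i
    refine Function.Bijective.sum_comp (e := fun σ : Fin m → Bool =>
      Function.update σ i (!σ i)) (Function.Involutive.bijective fun σ => ?_) (ρ · i)
    simp
  have hsum : ∑ _σ : Fin m → Bool, (m : ℝ≥0∞) * C ≤ ∑ σ, 2 * ∑ i, ρ σ i :=
    calc ∑ _σ : Fin m → Bool, (m : ℝ≥0∞) * C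
        = ∑ _σ : Fin m → Bool, ∑ _i : Fin m, C := by simp
      _ ≤ ∑ σ, ∑ i, (ρ σ i + ρ (Function.update σ i (!σ i)) i) :=
          Finset.sum_le_sum fun σ _ => Finset.sum_le_sum fun i _ => hρ σ i
      _ = ∑ i, ∑ σ, (ρ σ i + ρ (Function.update σ i (!σ i)) i) := Finset.sum_comm
      _ = ∑ i, 2 * ∑ σ, ρ σ i := by
          refine Finset.sum_congr rfl fun i _ => ?_
          rw [Finset.sum_add_distrib, hflip, two_mul]
      _ = ∑ σ, 2 * ∑ i, ρ σ i := by
          simp_rw [← Finset.mul_sum]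
          rw [Finset.sum_comm]
  by_contra! hlt
  exact absurd hsum
    (not_le.2 (ENNReal.sum_lt_sum_of_nonempty Finset.univ_nonempty fun σ _ => hlt σ))

/-! ### Lower bounds on the hypercube and on a line -/

/-- Two tasks that differ only in the sign of a small component `δ` along `u`: the squared
deviations of the actions from this component cannot be small for both. -/
theorem le_deviation_add_deviation (π : Policy d) (N : ℕ) {φ δ e : ℝ} (he : e ^ 2 = 1)
    (hδ : φ ^ 2 * δ ^ 4 * N ≤ 1 / 20) (θ u : EuclideanSpace ℝ (Fin d)) :
    ENNReal.ofReal (Real.exp (-4) / 10 * (N * δ ^ 2)) ≤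
      ∫⁻ h, ENNReal.ofReal
          (∑ t, (inner ℝ ((h t).1 : EuclideanSpace ℝ (Fin d)) u - δ * e) ^ 2)
        ∂(historyLaw π θ gaussianNoise N) +
      ∫⁻ h, ENNReal.ofReal
          (∑ t, (inner ℝ ((h t).1 : EuclideanSpace ℝ (Fin d)) u + δ * e) ^ 2)
        ∂(historyLaw π (θ + (-(2 * φ * δ * e)) • u) gaussianNoise N) := by
  set I := ∫⁻ h, ENNReal.ofReal
    (∑ t, (inner ℝ ((h t).1 : EuclideanSpace ℝ (Fin d)) u - δ * e) ^ 2)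
      ∂(historyLaw π θ gaussianNoise N) with hI
  have hexp : Real.exp (-4) ≤ 1 := Real.exp_le_one_iff.2 (by norm_num)
  have hNδ : 0 ≤ N * δ ^ 2 := by positivity
  -- Either the first deviation is already large, or its smallness bounds the information gathered
  -- about the sign.
  rcases le_total (ENNReal.ofReal (N * δ ^ 2 / 4)) I with h | h
  · refine (ENNReal.ofReal_le_ofReal ?_).trans (h.trans le_self_add)
    nlinarith [Real.exp_pos (-4)]
  refine two_point_bound π θ _ N ?_ (by fun_prop) (by fun_prop) hNδ fun h => ?_
  · calc ∫⁻ h, ENNReal.ofReal (∑ t, inner ℝ ((h t).1 : EuclideanSpace ℝ (Fin d))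
          ((-(2 * φ * δ * e)) • u) ^ 2) ∂(historyLaw π θ gaussianNoise N)
        ≤ ∫⁻ h, (ENNReal.ofReal (8 * φ ^ 2 * δ ^ 2) * ENNReal.ofReal
            (∑ t, (inner ℝ ((h t).1 : EuclideanSpace ℝ (Fin d)) u - δ * e) ^ 2) +
            ENNReal.ofReal (8 * φ ^ 2 * δ ^ 4 * N)) ∂(historyLaw π θ gaussianNoise N) := by
          refine lintegral_mono fun h => ?_
          rw [← ENNReal.ofReal_mul (by positivity), ← ENNReal.ofReal_add
            (mul_nonneg (by positivity) (Finset.sum_nonneg fun _ _ => sq_nonneg _))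
            (by positivity)]
          refine ENNReal.ofReal_le_ofReal ?_
          have hN : 8 * φ ^ 2 * δ ^ 4 * N = ∑ _t : Fin N, 8 * φ ^ 2 * δ ^ 4 := by
            simp; ring
          rw [hN, Finset.mul_sum, ← Finset.sum_add_distrib]
          refine Finset.sum_le_sum fun t _ => ?_
          rw [real_inner_smul_right]
          generalize inner ℝ ((h t).1 : EuclideanSpace ℝ (Fin d)) u = y
          have h1 : y ^ 2 ≤ 2 * (y - δ * e) ^ 2 + 2 * δ ^ 2 := by
            have : (δ * e) ^ 2 = δ ^ 2 := by rw [mul_pow, he, mul_one]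
            nlinarith [sq_nonneg (y - 2 * (δ * e))]
          have h2 := mul_le_mul_of_nonneg_left h1 (show 0 ≤ 4 * φ ^ 2 * δ ^ 2 by positivity)
          calc (-(2 * φ * δ * e) * y) ^ 2 = 4 * φ ^ 2 * δ ^ 2 * y ^ 2 * e ^ 2 := by ring
            _ = 4 * φ ^ 2 * δ ^ 2 * y ^ 2 := by rw [he, mul_one]
            _ ≤ _ := h2
            _ = _ := by ring
      _ = ENNReal.ofReal (8 * φ ^ 2 * δ ^ 2) * I + ENNReal.ofReal (8 * φ ^ 2 * δ ^ 4 * N) := by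
          rw [lintegral_add_right _ measurable_const, lintegral_const_mul _ (by fun_prop)]
          simp [hI]
      _ ≤ ENNReal.ofReal (8 * φ ^ 2 * δ ^ 2) * ENNReal.ofReal (N * δ ^ 2 / 4) +
            ENNReal.ofReal (8 * φ ^ 2 * δ ^ 4 * N) := by gcongr
      -- The sum is (2 + 8)φ²δ⁴N, whence the 1/20 in `hδ`.
      _ ≤ ENNReal.ofReal (1 / 2) := by
          rw [← ENNReal.ofReal_mul (by positivity),
            ← ENNReal.ofReal_add (by positivity) (by positivity)]
          refine ENNReal.ofReal_le_ofReal ?_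
          nlinarith
  · by_contra! hlt
    have h1 : 2 * (N * δ ^ 2) ≤
        ∑ t, (inner ℝ ((h t).1 : EuclideanSpace ℝ (Fin d)) u - δ * e) ^ 2 +
        ∑ t, (inner ℝ ((h t).1 : EuclideanSpace ℝ (Fin d)) u + δ * e) ^ 2 := by
      have hN : 2 * (N * δ ^ 2) = ∑ _t : Fin N, 2 * δ ^ 2 := by simp; ring
      rw [hN, ← Finset.sum_add_distrib]
      refine Finset.sum_le_sum fun t _ => ?_
      generalize inner ℝ ((h t).1 : EuclideanSpace ℝ (Fin d)) u = y
      have : (δ * e) ^ 2 = δ ^ 2 := by rw [mul_pow, he, mul_one]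
      nlinarith [sq_nonneg y]
    linarith [hlt.1, hlt.2]

/-- The two-point lower bound on a line. -/
theorem exists_sign_le_expectedRegret (π : Policy d) (N : ℕ) {Δ : ℝ} (hΔ : 0 ≤ Δ)
    (hN : Δ ^ 2 * N ≤ 1 / 8) {u : EuclideanSpace ℝ (Fin d)} (hu : ‖u‖ = 1) :
    ∃ e : ℝ, |e| = 1 ∧ ENNReal.ofReal (Real.exp (-4) / 20 * (N * Δ)) ≤
      expectedRegret π ((Δ * e) • u) gaussianNoise N := by
  have key := two_point_bound π ((Δ * 1) • u) ((-(2 * Δ)) • u) N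
    (f := fun h => ∑ t, (Δ - Δ * inner ℝ ((h t).1 : EuclideanSpace ℝ (Fin d)) u))
    (g := fun h => ∑ t, (Δ + Δ * inner ℝ ((h t).1 : EuclideanSpace ℝ (Fin d)) u))
    (c := N * Δ) ?_ (by fun_prop) (by fun_prop) (by positivity) ?_
  · have hθ : (Δ * 1) • u + (-(2 * Δ)) • u = (Δ * (-1)) • u := by
      rw [← add_smul]; congr 1; ring
    have h1 : ∫⁻ h, ENNReal.ofReal (∑ t, (Δ - Δ * inner ℝ ((h t).1 : EuclideanSpace ℝ (Fin d)) u))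
        ∂(historyLaw π ((Δ * 1) • u) gaussianNoise N) ≤
        expectedRegret π ((Δ * 1) • u) gaussianNoise N := by
      refine lintegral_mono fun h => ENNReal.ofReal_le_ofReal ?_
      refine le_trans (le_of_eq ?_) (sum_norm_sub_inner_le_regret _ h)
      simp [norm_smul, hu, abs_of_nonneg hΔ, real_inner_smul_right]
    have h2 : ∫⁻ h, ENNReal.ofReal (∑ t, (Δ + Δ * inner ℝ ((h t).1 : EuclideanSpace ℝ (Fin d)) u))
        ∂(historyLaw π ((Δ * (-1)) • u) gaussianNoise N) ≤
        expectedRegret π ((Δ * (-1)) • u) gaussianNoise N := by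
      refine lintegral_mono fun h => ENNReal.ofReal_le_ofReal ?_
      refine le_trans (le_of_eq ?_) (sum_norm_sub_inner_le_regret _ h)
      simp [norm_smul, hu, abs_of_nonneg hΔ, inner_neg_right, real_inner_smul_right]
    rw [hθ] at key
    have h3 := key.trans (add_le_add h1 h2)
    have h4 : ENNReal.ofReal (Real.exp (-4) / 10 * (N * Δ)) =
        ENNReal.ofReal (Real.exp (-4) / 20 * (N * Δ)) +
        ENNReal.ofReal (Real.exp (-4) / 20 * (N * Δ)) := by
      rw [← ENNReal.ofReal_add (by positivity) (by positivity)]; congr 1; ring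
    by_contra! hlt
    rw [h4] at h3
    exact absurd h3 (not_le.2 (ENNReal.add_lt_add (hlt 1 (by simp)) (hlt (-1) (by simp))))
  · calc ∫⁻ h, ENNReal.ofReal (∑ t, inner ℝ ((h t).1 : EuclideanSpace ℝ (Fin d))
          ((-(2 * Δ)) • u) ^ 2) ∂(historyLaw π ((Δ * 1) • u) gaussianNoise N)
        ≤ ∫⁻ _h, ENNReal.ofReal (1 / 2) ∂(historyLaw π ((Δ * 1) • u) gaussianNoise N) := by
          refine lintegral_mono fun h => ENNReal.ofReal_le_ofReal ?_
          calc ∑ t, inner ℝ ((h t).1 : EuclideanSpace ℝ (Fin d)) ((-(2 * Δ)) • u) ^ 2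
              ≤ ∑ _t : Fin N, 4 * Δ ^ 2 := by
                refine Finset.sum_le_sum fun t _ => ?_
                have hx : ‖((h t).1 : EuclideanSpace ℝ (Fin d))‖ ≤ 1 :=
                  mem_closedBall_zero_iff.1 (h t).1.2
                have h1 := abs_real_inner_le_norm ((h t).1 : EuclideanSpace ℝ (Fin d)) u
                rw [hu, mul_one] at h1
                have h2 := (sq_le_one_iff_abs_le_one _).2 (h1.trans hx)
                rw [real_inner_smul_right]
                nlinarith [sq_nonneg Δ]
            _ = 4 * (Δ ^ 2 * N) := by simp; ring
            _ ≤ 1 / 2 := by linarith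
      _ = ENNReal.ofReal (1 / 2) := by simp
  · intro h
    by_contra! hlt
    have : ∑ t, (Δ - Δ * inner ℝ ((h t).1 : EuclideanSpace ℝ (Fin d)) u) +
        ∑ t, (Δ + Δ * inner ℝ ((h t).1 : EuclideanSpace ℝ (Fin d)) u) = 2 * (N * Δ) := by
      rw [← Finset.sum_add_distrib]
      simp; ring
    have hNΔ : 0 ≤ N * Δ := by positivity
    linarith [hlt.1, hlt.2]

/-- The lower bound on a sphere of dimension `m`, by a hypercube of directions around a pole. -/
theorem exists_le_expectedRegret_sphere (π : Policy d) (N : ℕ) {m : ℕ} {φ δ : ℝ} (hφ : 0 ≤ φ)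
    (hδ : φ ^ 2 * δ ^ 4 * N ≤ 1 / 20) (hm : m * δ ^ 2 ≤ 1)
    {u : Fin (m + 1) → EuclideanSpace ℝ (Fin d)} (hu : Orthonormal ℝ u) :
    ∃ a : Fin (m + 1) → ℝ, ‖∑ i, a i • u i‖ = φ ∧
      ENNReal.ofReal (φ / 4 * (m * (Real.exp (-4) / 10 * (N * δ ^ 2)))) ≤
        expectedRegret π (∑ i, a i • u i) gaussianNoise N := by
  let e : Bool → ℝ := fun b => if b then 1 else -1
  have he : ∀ b, e b ^ 2 = 1 := by intro b; cases b <;> simp [e]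
  have he' : ∀ b, e (!b) = -e b := by intro b; cases b <;> simp [e]
  let w : (Fin m → Bool) → Fin (m + 1) → ℝ := fun σ =>
    Fin.cons (Real.sqrt (1 - m * δ ^ 2)) (fun i => δ * e (σ i))
  let W : (Fin m → Bool) → EuclideanSpace ℝ (Fin d) := fun σ => ∑ i, w σ i • u i
  have hW : ∀ σ, ‖W σ‖ = 1 := by
    intro σ
    have h1 : ‖W σ‖ ^ 2 = 1 := by
      rw [← real_inner_self_eq_norm_sq, hu.inner_sum]
      simp only [w, Fin.sum_univ_succ, Fin.cons_zero, Fin.cons_succ, conj_trivial]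
      rw [Real.mul_self_sqrt (by linarith)]
      have : ∀ i, δ * e (σ i) * (δ * e (σ i)) = δ ^ 2 := fun i => by
        rw [← sq, mul_pow, he, mul_one]
      simp [this]
    nlinarith [norm_nonneg (W σ)]
  have hWu : ∀ σ (i : Fin m), inner ℝ (W σ) (u i.succ) = δ * e (σ i) := fun σ i => by
    simp only [W]
    rw [hu.inner_left_fintype]
    simp [w]
  have hflip : ∀ σ i, φ • W (Function.update σ i (!σ i)) =
      φ • W σ + (-(2 * φ * δ * e (σ i))) • u i.succ := by
    intro σ i
    have h1 : ∀ j, w (Function.update σ i (!σ i)) j • u j =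
        w σ j • u j + if j = i.succ then (-(2 * δ * e (σ i))) • u j else 0 := by
      intro j
      refine Fin.cases ?_ (fun k => ?_) j
      · simp [w, (Fin.succ_ne_zero i).symm]
      · by_cases hk : k = i
        · subst hk
          simp only [w, Fin.cons_succ, Function.update_self, he', if_true, ← add_smul]
          congr 1; ring
        · simp [w, hk]
    simp only [W, h1, Finset.sum_add_distrib, Finset.sum_ite_eq', Finset.mem_univ, if_true,
      smul_add, smul_smul]
    congr 2; ring
  let ρ : (Fin m → Bool) → Fin m → ℝ≥0∞ := fun σ i =>
    ∫⁻ h, ENNReal.ofReal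
      (∑ t, (inner ℝ ((h t).1 : EuclideanSpace ℝ (Fin d)) (u i.succ) - δ * e (σ i)) ^ 2)
        ∂(historyLaw π (φ • W σ) gaussianNoise N)
  obtain ⟨σ, hσ⟩ := exists_vertex_le_sum ρ
    (ENNReal.ofReal (Real.exp (-4) / 10 * (N * δ ^ 2))) fun σ i => by
      have := le_deviation_add_deviation π N (he (σ i)) hδ (φ • W σ) (u i.succ)
      simpa only [ρ, hflip, Function.update_self, he', mul_neg, sub_neg_eq_add] using this
  refine ⟨fun i => φ * w σ i, ?_⟩
  have hθ : ∑ i, (φ * w σ i) • u i = φ • W σ := by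
    simp only [W, Finset.smul_sum, smul_smul]
  rw [hθ]
  have hnorm : ‖φ • W σ‖ = φ := by rw [norm_smul, hW, mul_one, Real.norm_of_nonneg hφ]
  refine ⟨hnorm, ?_⟩
  have hreg : ENNReal.ofReal (φ / 2) * ∑ i, ρ σ i ≤
      expectedRegret π (φ • W σ) gaussianNoise N := by
    simp only [ρ]
    rw [← lintegral_finsetSum _ (fun i _ => by fun_prop), ← lintegral_const_mul _ (by fun_prop)]
    refine lintegral_mono fun h => ?_
    rw [← ENNReal.ofReal_sum_of_nonneg
      (fun i _ => Finset.sum_nonneg fun t _ => sq_nonneg _), ← ENNReal.ofReal_mul (by positivity)]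
    refine ENNReal.ofReal_le_ofReal (le_trans ?_ (sum_norm_sub_inner_le_regret _ h))
    rw [Finset.sum_comm, Finset.mul_sum]
    refine Finset.sum_le_sum fun t _ => ?_
    have hx : ‖((h t).1 : EuclideanSpace ℝ (Fin d))‖ ≤ 1 :=
      mem_closedBall_zero_iff.1 (h t).1.2
    have h1 := half_norm_sub_sq_le hx (hW σ)
    -- Bessel's inequality, with the pole coordinate dropped.
    have h2 := (hu.comp _ (Fin.succ_injective m)).sum_inner_products_le
      (((h t).1 : EuclideanSpace ℝ (Fin d)) - W σ) (s := Finset.univ)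
    have h3 : ∑ i : Fin m, (inner ℝ ((h t).1 : EuclideanSpace ℝ (Fin d)) (u i.succ) -
        δ * e (σ i)) ^ 2 ≤ ‖((h t).1 : EuclideanSpace ℝ (Fin d)) - W σ‖ ^ 2 := by
      refine le_trans (le_of_eq (Finset.sum_congr rfl fun i _ => ?_)) h2
      rw [Real.norm_eq_abs, sq_abs, Function.comp_apply, inner_sub_right,
        real_inner_comm (W σ), hWu, real_inner_comm]
    rw [hnorm, real_inner_smul_right]
    nlinarith
  refine le_trans ?_ hreg
  have h5 : ENNReal.ofReal (φ / 4 * (m * (Real.exp (-4) / 10 * (N * δ ^ 2)))) =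
      ENNReal.ofReal (φ / 4) * (m * ENNReal.ofReal (Real.exp (-4) / 10 * (N * δ ^ 2))) := by
    rw [ENNReal.ofReal_mul (by positivity), ENNReal.ofReal_mul (by positivity),
      ENNReal.ofReal_natCast]
  have h6 : ENNReal.ofReal (φ / 2) = ENNReal.ofReal (φ / 4) * 2 := by
    rw [← ENNReal.ofReal_ofNat 2, ← ENNReal.ofReal_mul (by positivity)]; congr 1; ring
  rw [h5, h6, mul_assoc]
  gcongr

theorem le_minimaxRegret {I : Set (EuclideanSpace ℝ (Fin d))} {𝒩 : Set (ProbabilityMeasure ℝ)}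
    {N : ℕ} {C : ℝ≥0∞} {ν : ProbabilityMeasure ℝ} (hν : ν ∈ 𝒩)
    (h : ∀ π : Policy d, ∃ θ ∈ I, C ≤ expectedRegret π θ ν N) : C ≤ minimaxRegret I 𝒩 N := by
  refine le_iInf fun π => ?_
  obtain ⟨θ, hθ, hC⟩ := h π
  exact le_iSup₂_of_le θ hθ (le_iSup₂_of_le ν hν hC)

end LinearBandit

/-! ### Choice of constants -/

theorem lemma2 (φmax : ℝ) (hφmax : 0 < φmax) :
    ∃ c : ℝ, 0 < c ∧
      ∀ (d r N : ℕ) (B : Matrix (Fin d) (Fin r) ℝ) (φmin : ℝ)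
        (𝒩 : Set (ProbabilityMeasure ℝ)),
        r < d → d ^ 2 < N → B.rank = r →
        0 ≤ φmin → φmin ≤ φmax → (r = 1 → φmin = 0) →
        𝒩 ⊆ LinearBandit.subGaussianNoise → LinearBandit.gaussianNoise ∈ 𝒩 →
        ENNReal.ofReal (c * r * Real.sqrt N) ≤
          LinearBandit.minimaxRegret (LinearBandit.tasks B φmin φmax) 𝒩 N := by
  -- With δ² = k/√N, `k ≤ 1` gives mδ² ≤ 1, and φmax·k ≤ 1/5 gives φmax²δ⁴N ≤ 1/25.
  set k : ℝ := 1 / (1 + 5 * φmax) with hk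
  have hk0 : 0 < k := by positivity
  have hk1 : k ≤ 1 := by rw [hk, div_le_one (by positivity)]; linarith
  have hkφ : φmax * k ≤ 1 / 5 := by
    rw [hk, mul_one_div, div_le_div_iff₀ (by positivity) (by positivity)]; linarith
  -- The sphere yields 1/40 with r - 1 in place of r; r - 1 ≥ r/2 turns this into 1/80.
  refine ⟨Real.exp (-4) / 80 * (φmax * k), by positivity, ?_⟩
  intro d r N B φmin 𝒩 hrd hdN hB hφ0 hφ hr1 _ h𝒩
  have hN : (0 : ℝ) < N := by exact_mod_cast (Nat.zero_le _).trans_lt hdN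
  set s : ℝ := Real.sqrt N with hs
  have hs0 : 0 < s := Real.sqrt_pos.2 hN
  have hss : s ^ 2 = N := Real.sq_sqrt hN.le
  have hrs : (r : ℝ) ≤ s := by
    refine Real.le_sqrt_of_sq_le ?_
    have : r ^ 2 ≤ N := (Nat.pow_le_pow_left hrd.le 2).trans hdN.le
    exact_mod_cast this
  have h1s : 1 ≤ s := by
    refine Real.le_sqrt_of_sq_le ?_
    have : 1 ≤ N := by omega
    rw [one_pow]; exact_mod_cast this
  obtain ⟨u, hu, hspan⟩ := LinearBandit.exists_orthonormal_of_rank_eq hB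
  rcases r with _ | _ | m
  · simp
  · refine LinearBandit.le_minimaxRegret h𝒩 fun π => ?_
    have hφmin := hr1 rfl
    have hΔ : (φmax * k / s) ^ 2 * N ≤ 1 / 8 := by
      rw [← hss, div_pow, div_mul_cancel₀ _ (by positivity)]
      nlinarith [mul_pos hφmax hk0]
    obtain ⟨e, he, hreg⟩ := LinearBandit.exists_sign_le_expectedRegret π N
      (Δ := φmax * k / s) (by positivity) hΔ (hu.1 0)
    refine ⟨_, ⟨?_, ?_, ?_⟩, le_trans (ENNReal.ofReal_le_ofReal ?_) hreg⟩
    · obtain ⟨α, hα⟩ := hspan fun _ => φmax * k / s * e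
      exact ⟨α, by rw [← hα]; simp⟩
    · rw [hφmin]; exact norm_nonneg _
    · rw [norm_smul, hu.1 0, mul_one, norm_mul, Real.norm_eq_abs e, he, mul_one,
        Real.norm_of_nonneg (by positivity), div_le_iff₀ hs0]
      nlinarith
    · have : N * (φmax * k / s) = φmax * k * s := by
        rw [← hss]; field_simp
      rw [this]
      have : 0 ≤ Real.exp (-4) * (φmax * k * s) := by positivity
      push_cast
      linarith
  · refine LinearBandit.le_minimaxRegret h𝒩 fun π => ?_
    have hδ2 : Real.sqrt (k / s) ^ 2 = k / s := Real.sq_sqrt (by positivity)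
    have hδ4 : Real.sqrt (k / s) ^ 4 = k ^ 2 / N := by
      rw [← hss, ← div_pow, show 4 = 2 * 2 from rfl, pow_mul, hδ2]
    obtain ⟨a, ha, hreg⟩ := LinearBandit.exists_le_expectedRegret_sphere π N (m := m + 1)
      (φ := φmax) (δ := Real.sqrt (k / s)) hφmax.le
      (by
        rw [hδ4, mul_assoc, div_mul_cancel₀ _ hN.ne']
        nlinarith [mul_pos hφmax hk0])
      (by
        rw [hδ2, mul_div_assoc', div_le_one hs0]
        push_cast at hrs ⊢
        nlinarith) hu
    refine ⟨_, ⟨hspan a, ?_, ?_⟩, le_trans (ENNReal.ofReal_le_ofReal ?_) hreg⟩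
    · rw [ha]; exact hφ
    · rw [ha]
    · have h1 : N * Real.sqrt (k / s) ^ 2 = k * s := by
        rw [hδ2, ← hss]; field_simp
      rw [h1]
      have : 0 ≤ Real.exp (-4) * (φmax * k * s) * m := by positivity
      push_cast
      linarith
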